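/- Let $G$ be a finite group, written multiplicatively. A sequence over $G$ is a finite multiset of elements of $G$, its length is the number of its terms counted with multiplicity, and a subsequence is a sub-multiset. A sequence is called product-one if its terms can be multiplied in some order so that the product is $1$. The small Davenport constant $\mathsf d(G)$ is the maximal length of a sequence over $G$ that has no non-empty product-one subsequence. The Gao constant $\mathsf E(G)$ is the smallest positive integer $N$ such that every sequence over $G$ of length at least $N$ has a product-one subsequence of length $|G|$. **Theorem 1.4.** Let $G$ be the non-abelian group of order $27$ and exponent $3$ (the Heisenberg group $H_{27}$). Then $\mathsf d(G) = 6$ and $\mathsf E(G) = 33$. In particular, $\mathsf E(G) = \mathsf d(G) + |G|$. -/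

import Mathlib

namespace ProductOne

/-- A finite unordered sequence over `G`, i.e. an element of the free abelian monoid with basis `G`.
Its length is `Multiset.card`, the multiplicity of a term is `Multiset.count`, and `T ≤ S` says
that `T` is a subsequence of `S` (every multiplicity in `T` is at most the one in `S`). -/
abbrev Sequence (G : Type*) : Type _ := Multiset G

/-- `π(S)`: the set of all products of the terms of `S`, taken in an arbitrary order. -/
def products {G : Type*} [Group G] (S : Sequence G) : Set G :=
  {g | ∃ l : List G, (l : Multiset G) = S ∧ l.prod = g}

/-- `Π(S)`: the union of the sets `π(T)` over all non-trivial subsequences `T` of `S`. -/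
def subproducts {G : Type*} [Group G] (S : Sequence G) : Set G :=
  {g | ∃ T : Sequence G, T ≠ 0 ∧ T ≤ S ∧ g ∈ products T}

/-- The lengths of the sequences over `G` that have no non-trivial product-one subsequence. -/
def productOneFreeLengths (G : Type*) [Group G] : Set ℕ :=
  {n | ∃ S : Sequence G, Multiset.card S = n ∧ (1 : G) ∉ subproducts S}

/-- The small Davenport constant `d(G)` of a finite group: the maximal length of a sequence over
`G` that has no non-trivial product-one subsequence. -/
noncomputable def smallDavenport (G : Type*) [Group G] : ℕ :=
  sSup (productOneFreeLengths G)

/-- The positive integers `N` such that every sequence over `G` of length at least `N` has a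
product-one subsequence of length `|G|`. -/
def gaoBounds (G : Type*) [Group G] : Set ℕ :=
  {N | 0 < N ∧ ∀ S : Sequence G, N ≤ Multiset.card S →
    ∃ T : Sequence G, T ≤ S ∧ Multiset.card T = Nat.card G ∧ (1 : G) ∈ products T}

/-- The Gao constant `E(G)` of a finite group: the smallest positive integer `N` such that every
sequence over `G` of length at least `N` has a product-one subsequence of length `|G|`. -/
noncomputable def gaoConstant (G : Type*) [Group G] : ℕ :=
  sInf (gaoBounds G)

end ProductOne

/-!
The group `G` is the Heisenberg group over `ZMod 3`. It carries coordinates `v : G → (ZMod 3) ^ 2`,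
a homomorphism with central kernel, and `c : G → ZMod 3` with
`c (x * y) = c x + c y + det (v x) (v y)` (`exists_heisenbergCoordinates`). For both upper bounds,
a Chevalley–Warning argument in the elementary abelian group `(ZMod 3) ^ 3` gives a subsequence `T`
along which all three coordinates sum to zero: a non-empty one inside any 7 terms
(`exists_nonempty_subset_sum_eq_zero`), and one of length 27 inside any 33 terms
(`exists_card_eq_sum_eq_zero`).

It remains to compare the sums of coordinates with products in `G`. If the terms of `T` commute, the
product is `1`. If they do not, but the sum of `v` is zero, then the products of `T` are central and
* they take all values as soon as four terms are non-central, because then there are two disjoint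
  non-commuting pairs that can be interchanged independently (`one_mem_products_of_four_le_card`);
* they always include `1` when the sum of `c` is not zero (`one_mem_products_of_sum_c_ne_zero`).

So `T` fails only if its non-central terms are three pairwise non-commuting elements
(`one_mem_products_or_exists_triple`). If the whole sequence has four further non-central terms, the
triple can be replaced by a longer zero-sum family that is not contained in a line
(`exists_four_le_card_sum_eq_zero`, which rests on the Davenport constant 5 of `(ZMod 3) ^ 2`).
Otherwise there are spare central terms: adding or removing one (for 7 terms), or exchanging one (for 33
terms), makes the sum of `c` non-zero, unless the spare term is `1`, respectively all of the at least 27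
central terms are equal, and 27 equal central elements have product `1`.

For the lower bounds, `x, x, y, y, z, z` with `x`, `y`, `z` a basis in coordinates is product-one
free, and adding 26 copies of `1` gives a sequence of length 32 without product-one subsequence of
length 27.
-/

namespace ProductOne

/-! ### Zero-sum subsequences over elementary abelian 3-groups -/

section ZeroSum

open MvPolynomial

/-- A combinatorial form of the Chevalley–Warning theorem: substituting `X i ^ 2` for `X i` turns a
common zero over `ZMod 3` into a common zero with coordinates in `{0, 1}`, that is, into a set. -/
theorem exists_nonempty_eval_indicator_eq_zero {ι κ : Type*} [Fintype ι] [DecidableEq ι]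
    [Fintype κ] (P : κ → MvPolynomial ι (ZMod 3))
    (hdeg : (∑ k, (P k).totalDegree) * 2 < Fintype.card ι) (h0 : ∀ k, eval 0 (P k) = 0) :
    ∃ T : Finset ι, T.Nonempty ∧ ∀ k, eval (fun i => if i ∈ T then 1 else 0) (P k) = 0 := by
  have hP : ∀ (x : ι → ZMod 3) k, eval x (expand 2 (P k)) = eval (fun i => x i ^ 2) (P k) := by
    intro x k
    rw [← coe_aeval_eq_eval, RingHom.coe_coe, aeval_expand]
    rfl
  have hdvd := char_dvd_card_solutions_of_fintype_sum_lt (K := ZMod 3) 3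
    (f := fun k => expand 2 (P k)) (by simpa [totalDegree_expand, ← Finset.sum_mul] using hdeg)
  have hz : ∀ k, eval (0 : ι → ZMod 3) (expand 2 (P k)) = 0 := by
    intro k
    rw [hP]
    simpa [Pi.zero_def] using h0 k
  have hcard : 1 < Fintype.card {x : ι → ZMod 3 // ∀ k, eval x (expand 2 (P k)) = 0} := by
    have hpos : 0 < Fintype.card {x : ι → ZMod 3 // ∀ k, eval x (expand 2 (P k)) = 0} :=
      Fintype.card_pos_iff.mpr ⟨⟨0, hz⟩⟩
    have := Nat.le_of_dvd hpos hdvd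
    omega
  obtain ⟨⟨x, hx⟩, hne⟩ := Fintype.exists_ne_of_one_lt_card hcard ⟨0, hz⟩
  refine ⟨Finset.univ.filter fun i => x i ≠ 0, ?_, fun k => ?_⟩
  · obtain ⟨i, hi⟩ := Function.ne_iff.mp fun h => hne (Subtype.ext h)
    exact ⟨i, by simpa using hi⟩
  · have hsq : ∀ a : ZMod 3, (if a ≠ 0 then (1 : ZMod 3) else 0) = a ^ 2 := by decide
    have hx' := hx k
    rw [hP] at hx'
    simpa only [Finset.mem_filter, Finset.mem_univ, true_and, hsq] using hx'

theorem totalDegree_sum_C_mul_X_le {ι R : Type*} [Fintype ι] [CommSemiring R] [Nontrivial R]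
    (g : ι → R) :
    (∑ i, C (g i) * X i : MvPolynomial ι R).totalDegree ≤ 1 := by
  refine (totalDegree_finsetSum _ _).trans (Finset.sup_le fun i _ => ?_)
  refine (totalDegree_mul _ _).trans ?_
  simp

theorem totalDegree_esymm_le (ι R : Type*) [Fintype ι] [CommSemiring R] [Nontrivial R]
    (n : ℕ) : (esymm ι R n).totalDegree ≤ n := by
  refine (totalDegree_finsetSum _ _).trans (Finset.sup_le fun t ht => ?_)
  refine (totalDegree_finsetProd _ _).trans ?_
  simp [(Finset.mem_powersetCard.mp ht).2]

theorem eval_indicator_sum_C_mul_X {ι R : Type*} [Fintype ι] [DecidableEq ι] [CommSemiring R]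
    (g : ι → R) (T : Finset ι) :
    eval (fun i => if i ∈ T then 1 else 0) (∑ i, C (g i) * X i) = ∑ i ∈ T, g i := by
  simp

theorem eval_indicator_esymm {ι R : Type*} [Fintype ι] [DecidableEq ι] [CommSemiring R]
    (n : ℕ) (T : Finset ι) :
    eval (fun i => if i ∈ T then 1 else 0) (esymm ι R n) = (T.card.choose n : R) := by
  have h : ∀ t ∈ Finset.powersetCard n (Finset.univ : Finset ι),
      (∏ i ∈ t, if i ∈ T then (1 : R) else 0) = if t ⊆ T then 1 else 0 := by
    intro t _
    rw [Finset.prod_ite_zero]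
    simp [Finset.subset_iff]
  simp only [esymm, map_sum, map_prod, eval_X]
  rw [Finset.sum_congr rfl h, Finset.sum_boole]
  congr 1
  rw [← Finset.card_powersetCard]
  congr 1
  ext t
  simp [Finset.mem_powersetCard, and_comm]

/-- Upper bound for the Davenport constant of `(ZMod 3) ^ κ`: more than `2 * |κ|` elements have a
nonempty zero-sum subfamily. -/
theorem exists_nonempty_subset_sum_eq_zero {ι κ : Type*} [Fintype κ] (A : Finset ι)
    (g : κ → ι → ZMod 3) (hA : 2 * Fintype.card κ < A.card) :
    ∃ T ⊆ A, T.Nonempty ∧ ∀ k, ∑ i ∈ T, g k i = 0 := by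
  classical
  obtain ⟨T, hT, h⟩ := exists_nonempty_eval_indicator_eq_zero
    (fun k => ∑ i : A, C (g k i) * X i) (by
      have : ∑ k, (∑ i : A, C (g k i) * X i : MvPolynomial A (ZMod 3)).totalDegree
          ≤ ∑ _k : κ, 1 := Finset.sum_le_sum fun k _ => totalDegree_sum_C_mul_X_le _
      simp only [Finset.sum_const, Finset.card_univ, smul_eq_mul, mul_one] at this
      rw [Fintype.card_coe]
      omega) (by simp)
  refine ⟨T.map (Function.Embedding.subtype _), ?_, by simpa using hT, fun k => ?_⟩
  · intro i hi
    obtain ⟨j, -, rfl⟩ := Finset.mem_map.mp hi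
    exact j.2
  · rw [Finset.sum_map, ← h k, eval_indicator_sum_C_mul_X]
    rfl

/-- Among 33 elements of `(ZMod 3) ^ 3` there are 27 with sum zero. By Lucas' theorem the condition
`27 ∣ |T|` says that the elementary symmetric polynomials of degrees 1, 3 and 9 vanish at the
indicator of `T`; together with the three linear equations this makes a total degree
`13 + 3 = 16 < 33 / 2`. -/
theorem exists_card_eq_sum_eq_zero {ι : Type*} [Fintype ι] (hι : Fintype.card ι = 33)
    (g : Fin 3 → ι → ZMod 3) :
    ∃ T : Finset ι, T.card = 27 ∧ ∀ k, ∑ i ∈ T, g k i = 0 := by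
  classical
  obtain ⟨T, hT, h⟩ := exists_nonempty_eval_indicator_eq_zero (κ := Fin 3 ⊕ Fin 3)
    (Sum.elim (fun k => ∑ i, C (g k i) * X i) fun k => esymm ι (ZMod 3) (3 ^ (k : ℕ))) (by
      have h1 : ∑ k : Fin 3, (∑ i, C (g k i) * X i : MvPolynomial ι (ZMod 3)).totalDegree
          ≤ ∑ _k : Fin 3, 1 := Finset.sum_le_sum fun k _ => totalDegree_sum_C_mul_X_le _
      have h2 : ∑ k : Fin 3, (esymm ι (ZMod 3) (3 ^ (k : ℕ))).totalDegree
          ≤ ∑ k : Fin 3, 3 ^ (k : ℕ) := Finset.sum_le_sum fun k _ => totalDegree_esymm_le _ _ _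
      have h3 : ∑ k : Fin 3, 3 ^ (k : ℕ) = 13 := by decide
      simp only [Finset.sum_const, Finset.card_univ, Fintype.card_fin, smul_eq_mul] at h1
      simp only [Fintype.sum_sum_type, Sum.elim_inl, Sum.elim_inr]
      omega) (by
      rintro (k | k)
      · simp
      · have := eval_indicator_esymm (R := ZMod 3) (3 ^ (k : ℕ)) (∅ : Finset ι)
        simp only [Finset.notMem_empty, if_false, Finset.card_empty] at this
        rw [Sum.elim_inr, Pi.zero_def, this, Nat.choose_eq_zero_of_lt (by positivity),
          Nat.cast_zero])
  refine ⟨T, ?_, fun k => by simpa using h (Sum.inl k)⟩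
  have hle : T.card ≤ 33 := hι ▸ T.card_le_univ
  have hpos : 0 < T.card := hT.card_pos
  have hdvd : ∀ k : Fin 3, 3 ∣ T.card.choose (3 ^ (k : ℕ)) := by
    intro k
    rw [← ZMod.natCast_eq_zero_iff, ← eval_indicator_esymm]
    exact h (Sum.inr k)
  have key : ∀ n : Fin 34, 0 < (n : ℕ) →
      (∀ k : Fin 3, 3 ∣ (n : ℕ).choose (3 ^ (k : ℕ))) → (n : ℕ) = 27 := by
    intro n hn hk
    have h0 := hk 0
    have h1 := hk 1
    have h2 := hk 2
    clear hk
    simp only [Nat.choose_one_right, Fin.val_zero, pow_zero, Fin.val_one, pow_one,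
      Fin.val_two] at h0 h1 h2
    obtain ⟨n, hn'⟩ := n
    simp only at *
    obtain ⟨m, rfl⟩ := h0
    have hm : m < 12 := by omega
    interval_cases m <;> first
      | rfl
      | (exfalso; revert h1; decide)
      | (exfalso; revert h2; decide)
      | omega
  exact key ⟨T.card, by omega⟩ hpos hdvd

end ZeroSum

/-! ### Coordinates on the Heisenberg group -/

/-- The determinant on `(ZMod 3) ^ 2`. -/
def det (u w : ZMod 3 × ZMod 3) : ZMod 3 := u.1 * w.2 - u.2 * w.1

theorem det_add_left (u u' w : ZMod 3 × ZMod 3) : det (u + u') w = det u w + det u' w := by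
  simp only [det, Prod.fst_add, Prod.snd_add]; ring

theorem det_add_right (u w w' : ZMod 3 × ZMod 3) : det u (w + w') = det u w + det u w' := by
  simp only [det, Prod.fst_add, Prod.snd_add]; ring

theorem det_neg_right (u w : ZMod 3 × ZMod 3) : det u (-w) = -det u w := by
  simp only [det, Prod.fst_neg, Prod.snd_neg]; ring

theorem det_self (u : ZMod 3 × ZMod 3) : det u u = 0 := by
  simp only [det]; ring

theorem det_swap (u w : ZMod 3 × ZMod 3) : det w u = -det u w := by
  simp only [det]; ring

theorem det_zero_left (w : ZMod 3 × ZMod 3) : det 0 w = 0 := by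
  simp [det]

theorem det_zero_right (w : ZMod 3 × ZMod 3) : det w 0 = 0 := by
  simp [det]

theorem det_sum_left {ι : Type*} (T : Finset ι) (u : ι → ZMod 3 × ZMod 3) (w : ZMod 3 × ZMod 3) :
    det (∑ i ∈ T, u i) w = ∑ i ∈ T, det (u i) w :=
  map_sum (AddMonoidHom.mk' (fun u => det u w) fun _ _ => det_add_left _ _ _) u T

theorem det_ne_zero_or_of_ne_zero {u w x : ZMod 3 × ZMod 3} (h : det u w ≠ 0) (hx : x ≠ 0) :
    det x u ≠ 0 ∨ det x w ≠ 0 := by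
  revert u w x
  decide

/-- Symmetric coordinates on a Heisenberg group over `ZMod 3`: a homomorphism `v` onto
`(ZMod 3) ^ 2` with central kernel, and a function `c` that is additive up to the determinant.
The factor of the determinant is `1` (and not `1 / 2`), so that reversing the order of the
factors of a product changes the sign of the deviation of `c` from additivity. -/
structure HeisenbergCoordinates (G : Type*) [Group G] where
  /-- The image in the abelianization. -/
  v : G → ZMod 3 × ZMod 3
  /-- The symmetric central coordinate. -/
  c : G → ZMod 3
  v_mul : ∀ x y, v (x * y) = v x + v y
  c_mul : ∀ x y, c (x * y) = c x + c y + det (v x) (v y)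
  eq_one : ∀ x, v x = 0 → c x = 0 → x = 1
  surj : ∀ w a, ∃ x, v x = w ∧ c x = a

/-- In a group of exponent three every element commutes with its conjugates. -/
theorem commute_conj {G : Type*} [Group G] (h : ∀ x : G, x ^ 3 = 1) (a b : G) :
    Commute a (b * a * b⁻¹) := by
  have h' : ∀ x : G, x * x * x = 1 := fun x => by rw [← h x, pow_succ, pow_two]
  have hbb : b * b = b⁻¹ := eq_inv_of_mul_eq_one_left (h' b)
  have hbb' : b⁻¹ * b⁻¹ = b := by rw [← mul_inv_rev, hbb, inv_inv]
  have h1 : a * ((b * a * b⁻¹) * (b⁻¹ * a * b)) = 1 := by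
    calc a * ((b * a * b⁻¹) * (b⁻¹ * a * b)) = a * b * a * (b⁻¹ * b⁻¹) * a * b := by group
      _ = (a * b) * (a * b) * (a * b) := by rw [hbb']; group
      _ = 1 := h' _
  have h2 : a * ((b⁻¹ * a * b) * (b * a * b⁻¹)) = 1 := by
    calc a * ((b⁻¹ * a * b) * (b * a * b⁻¹)) = a * b⁻¹ * a * (b * b) * a * b⁻¹ := by group
      _ = (a * b⁻¹) * (a * b⁻¹) * (a * b⁻¹) := by rw [hbb]; group
      _ = 1 := h' _
  have h3 : Commute (b * a * b⁻¹) (b⁻¹ * a * b) := mul_left_cancel (h1.trans h2.symm)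
  have h4 : b⁻¹ * (b⁻¹ * a * b) * b⁻¹⁻¹ = b * a * b⁻¹ := by
    calc b⁻¹ * (b⁻¹ * a * b) * b⁻¹⁻¹ = (b⁻¹ * b⁻¹) * a * (b * b) := by group
      _ = b * a * b⁻¹ := by rw [hbb, hbb']
  have h5 : b⁻¹ * (b * a * b⁻¹) * b⁻¹⁻¹ = a := by group
  have h6 := (Commute.conj_iff b⁻¹).mpr h3
  rwa [h4, h5] at h6

theorem pow_val_add {G : Type*} [Group G] {x : G} (h : x ^ 3 = 1) (i j : ZMod 3) :
    x ^ (i + j).val = x ^ i.val * x ^ j.val := by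
  rw [ZMod.val_add, ← pow_eq_pow_mod _ h, pow_add]

theorem pow_val_mul {G : Type*} [Group G] {x : G} (h : x ^ 3 = 1) (i j : ZMod 3) :
    x ^ (i * j).val = x ^ (i.val * j.val) := by
  rw [ZMod.val_mul, ← pow_eq_pow_mod _ h]

theorem pow_mul_pow_of_mul_eq {G : Type*} [Group G] {a b z : G} (hab : b * a = a * b * z)
    (ha : Commute a z) (hb : Commute b z) (m n : ℕ) :
    b ^ m * a ^ n = a ^ n * b ^ m * z ^ (m * n) := by
  have h1 : ∀ m : ℕ, b ^ m * a = a * b ^ m * z ^ m := by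
    intro m
    induction m with
    | zero => simp
    | succ m ih =>
      calc b ^ (m + 1) * a = b * (b ^ m * a) := by rw [pow_succ', mul_assoc]
        _ = b * a * b ^ m * z ^ m := by rw [ih]; simp only [mul_assoc]
        _ = a * b * (z * b ^ m) * z ^ m := by rw [hab]; simp only [mul_assoc]
        _ = a * b ^ (m + 1) * z ^ (m + 1) := by
          rw [← (hb.pow_left m).eq, pow_succ' b, pow_succ' z]; simp only [mul_assoc]
  induction n with
  | zero => simp
  | succ n ih =>
    calc b ^ m * a ^ (n + 1) = b ^ m * a ^ n * a := by rw [pow_succ, mul_assoc]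
      _ = a ^ n * b ^ m * (z ^ (m * n) * a) := by rw [ih]; simp only [mul_assoc]
      _ = a ^ n * (b ^ m * a) * z ^ (m * n) := by
        rw [← (ha.pow_right (m * n)).eq]; simp only [mul_assoc]
      _ = a ^ (n + 1) * b ^ m * z ^ (m * (n + 1)) := by
        rw [h1, pow_succ, mul_add, mul_one, add_comm (m * n), pow_add]; simp only [mul_assoc]

/-- With non-commuting `a`, `b` and `b * a = a * b * z`, every element has a unique normal form
`a ^ i * b ^ j * z ^ k`, and `(i, j)` and `k + i * j` are symmetric coordinates. -/
theorem exists_heisenbergCoordinates {G : Type*} [Group G] (hcard : Nat.card G = 27)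
    (hexp : Monoid.exponent G = 3) (hnonab : ¬ ∀ a b : G, a * b = b * a) :
    Nonempty (HeisenbergCoordinates G) := by
  have h3 : ∀ x : G, x ^ 3 = 1 := fun x => hexp ▸ Monoid.pow_exponent_eq_one x
  push Not at hnonab
  obtain ⟨a, b, hab⟩ := hnonab
  obtain ⟨z, hz⟩ : ∃ z, b * a = a * b * z := ⟨(a * b)⁻¹ * (b * a), by group⟩
  have hz' : z = b⁻¹ * a⁻¹ * b * a := by
    rw [eq_comm, ← mul_right_inj (a * b), ← hz]; group
  have haz : Commute a z := by
    have h := (commute_conj h3 a b⁻¹).inv_right.mul_right (Commute.refl a)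
    rwa [show (b⁻¹ * a * b⁻¹⁻¹)⁻¹ * a = z by rw [hz']; group] at h
  have hbz : Commute b z := by
    have h := (Commute.refl b).inv_right.mul_right (commute_conj h3 b a⁻¹)
    rwa [show b⁻¹ * (a⁻¹ * b * a⁻¹⁻¹) = z by rw [hz']; group] at h
  have hz1 : z ≠ 1 := by
    rintro rfl
    exact hab (by rw [hz, mul_one])
  let φ : ZMod 3 × ZMod 3 × ZMod 3 → G := fun t => a ^ t.1.val * b ^ t.2.1.val * z ^ t.2.2.val
  have hmul : ∀ s t, φ s * φ t =
      φ (s.1 + t.1, s.2.1 + t.2.1, s.2.2 + t.2.2 + s.2.1 * t.1) := by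
    rintro ⟨i, j, k⟩ ⟨i', j', k'⟩
    simp only [φ, pow_val_add (h3 _), pow_val_mul (h3 _)]
    have hzz : ∀ m n, z ^ m * a ^ n = a ^ n * z ^ m := fun m n => (haz.pow_pow n m).eq.symm
    have hzb : ∀ m n, z ^ m * b ^ n = b ^ n * z ^ m := fun m n => (hbz.pow_pow n m).eq.symm
    calc a ^ i.val * b ^ j.val * z ^ k.val * (a ^ i'.val * b ^ j'.val * z ^ k'.val)
        = a ^ i.val * b ^ j.val * (z ^ k.val * a ^ i'.val) * b ^ j'.val * z ^ k'.val := by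
          simp only [mul_assoc]
      _ = a ^ i.val * (b ^ j.val * a ^ i'.val) * (z ^ k.val * b ^ j'.val) * z ^ k'.val := by
          rw [hzz]; simp only [mul_assoc]
      _ = a ^ i.val * a ^ i'.val * b ^ j.val * (z ^ (j.val * i'.val) * b ^ j'.val) *
            z ^ k.val * z ^ k'.val := by
          rw [pow_mul_pow_of_mul_eq hz haz hbz, hzb k.val]; simp only [mul_assoc]
      _ = a ^ i.val * a ^ i'.val * (b ^ j.val * b ^ j'.val) *
            (z ^ (j.val * i'.val) * (z ^ k.val * z ^ k'.val)) := by
          rw [hzb]; simp only [mul_assoc]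
      _ = _ := by rw [((Commute.refl z).pow_pow _ _).mul_right ((Commute.refl z).pow_pow _ _)]
  have hzinj : ∀ i j : ZMod 3, z ^ i.val = z ^ j.val → i = j := by
    intro i j h
    rw [pow_inj_mod, orderOf_eq_prime (h3 z) hz1, Nat.mod_eq_of_lt i.val_lt,
      Nat.mod_eq_of_lt j.val_lt] at h
    exact ZMod.val_injective 3 h
  have hφz : ∀ i j k m, φ (i, j, k + m) = φ (i, j, k) * z ^ m.val := by
    intro i j k m
    simp only [φ, pow_val_add (h3 _), mul_assoc]
  have hinj : Function.Injective φ := by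
    rintro ⟨i, j, k⟩ ⟨i', j', k'⟩ h
    -- commuting with `b` and with `a` recovers the first two exponents
    have hi : ∀ i j k, φ (0, 1, 0) * φ (i, j, k) = φ (i, j, k) * φ (0, 1, 0) * z ^ i.val := by
      intro i j k
      rw [hmul, hmul, ← hφz]
      simp [add_comm]
    have hj : ∀ i j k, φ (i, j, k) * φ (1, 0, 0) = φ (1, 0, 0) * φ (i, j, k) * z ^ j.val := by
      intro i j k
      rw [hmul, hmul, ← hφz]
      simp [add_comm]
    have hi1 := hi i j k
    rw [h, hi i' j' k', mul_right_inj] at hi1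
    have hj1 := hj i j k
    rw [h, hj i' j' k', mul_right_inj] at hj1
    obtain rfl := hzinj _ _ hi1
    obtain rfl := hzinj _ _ hj1
    simp only [φ, mul_right_inj] at h
    rw [hzinj _ _ h]
  have : Finite G := Nat.finite_of_card_ne_zero (by omega)
  have hbij : Function.Bijective φ :=
    hinj.bijective_of_nat_card_le (by simp [hcard])
  let e := (Equiv.ofBijective φ hbij).symm
  have he : ∀ x y, e (x * y) = ((e x).1 + (e y).1, (e x).2.1 + (e y).2.1,
      (e x).2.2 + (e y).2.2 + (e x).2.1 * (e y).1) := by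
    intro x y
    rw [Equiv.symm_apply_eq, Equiv.ofBijective_apply, ← hmul]
    simp only [← Equiv.ofBijective_apply φ hbij, e, Equiv.apply_symm_apply]
  refine ⟨fun x => ((e x).1, (e x).2.1), fun x => (e x).2.2 + (e x).1 * (e x).2.1,
    fun x y => ?_, fun x y => ?_, fun x h0 h1 => ?_, fun w t => ?_⟩
  · rw [he]; rfl
  · have h4 : (3 : ZMod 3) = 0 := rfl
    rw [he]
    simp only [det]
    linear_combination (e x).2.1 * (e y).1 * h4
  · simp only [Prod.mk_eq_zero] at h0
    simp only [h0.1, h0.2, mul_zero, add_zero] at h1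
    have h : e x = 0 := Prod.ext h0.1 (Prod.ext h0.2 h1)
    rw [Equiv.symm_apply_eq, Equiv.ofBijective_apply] at h
    simp [h, φ]
  · refine ⟨φ (w.1, w.2, t - w.1 * w.2), ?_⟩
    have h : e (φ (w.1, w.2, t - w.1 * w.2)) = (w.1, w.2, t - w.1 * w.2) := by
      rw [Equiv.symm_apply_eq, Equiv.ofBijective_apply]
    rw [h]
    exact ⟨rfl, sub_add_cancel _ _⟩

/-! ### Sufficient conditions for a sequence to be product-one -/

theorem sum_map_eq_of_coe_eq_map {G ι M : Type*} [AddCommMonoid M] {f : ι → G} {T : Finset ι}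
    {l : List G}
    (h : (l : Multiset G) = T.val.map f) (g : G → M) :
    (l.map g).sum = ∑ i ∈ T, g (f i) := by
  have h' : (T.val.map fun i => g (f i)) = (T.val.map f).map g := (Multiset.map_map g f _).symm
  rw [Finset.sum_eq_multiset_sum, h', ← h, Multiset.map_coe, Multiset.sum_coe]

namespace HeisenbergCoordinates

variable {G : Type*} [Group G] (H : HeisenbergCoordinates G)

theorem v_one : H.v 1 = 0 := by
  have h := H.v_mul 1 1
  rwa [mul_one, left_eq_add] at h

theorem c_one : H.c 1 = 0 := by
  have h := H.c_mul 1 1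
  rwa [mul_one, H.v_one, det_zero_left, add_zero, left_eq_add] at h

theorem v_prod (l : List G) : H.v l.prod = (l.map H.v).sum := by
  induction l with
  | nil => simpa using H.v_one
  | cons x l ih => simp [H.v_mul, ih]

theorem c_prod_add_c_prod_reverse (l : List G) :
    H.c l.prod + H.c l.reverse.prod = 2 * (l.map H.c).sum := by
  induction l with
  | nil => simp [H.c_one]
  | cons x l ih =>
    have hv : H.v l.reverse.prod = H.v l.prod := by
      rw [v_prod, v_prod, List.map_reverse, List.sum_reverse]
    simp only [List.prod_cons, List.reverse_cons, List.prod_append, List.prod_nil, mul_one,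
      List.map_cons, List.sum_cons, H.c_mul, hv]
    linear_combination ih + det_swap (H.v x) (H.v l.prod)

theorem c_prod_of_forall_det_eq_zero (l : List G)
    (h : ∀ x ∈ l, ∀ y ∈ l, det (H.v x) (H.v y) = 0) : H.c l.prod = (l.map H.c).sum := by
  have hdet : ∀ (u : ZMod 3 × ZMod 3) (l : List G), (∀ y ∈ l, det u (H.v y) = 0) →
      det u (H.v l.prod) = 0 := by
    intro u l hl
    induction l with
    | nil => simp [H.v_one, det_zero_right]
    | cons y l ih =>
      rw [List.prod_cons, H.v_mul, det_add_right, hl y (by simp),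
        ih fun z hz => hl z (List.mem_cons_of_mem _ hz), add_zero]
  induction l with
  | nil => simpa using H.c_one
  | cons x l ih =>
    rw [List.prod_cons, H.c_mul, List.map_cons, List.sum_cons,
      ih fun y hy z hz => h y (List.mem_cons_of_mem _ hy) z (List.mem_cons_of_mem _ hz),
      hdet _ _ fun y hy => h x (by simp) y (List.mem_cons_of_mem _ hy), add_zero]

theorem c_mul_mul_of_v_eq_zero {x y r : G} (h : H.v x + H.v y + H.v r = 0) :
    H.c (x * y * r) = H.c x + H.c y + H.c r + det (H.v x) (H.v y) := by
  rw [H.c_mul, H.c_mul, H.v_mul, ← neg_eq_of_add_eq_zero_right h, det_neg_right, det_self]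
  ring

variable {ι : Type*} {f : ι → G} {T : Finset ι}

theorem one_mem_products_of_forall_det_eq_zero
    (hdet : ∀ i ∈ T, ∀ j ∈ T, det (H.v (f i)) (H.v (f j)) = 0)
    (hv : ∑ i ∈ T, H.v (f i) = 0) (hc : ∑ i ∈ T, H.c (f i) = 0) :
    (1 : G) ∈ products (T.val.map f) := by
  refine ⟨T.toList.map f, by rw [← Multiset.map_coe, Finset.coe_toList], H.eq_one _ ?_ ?_⟩
  · rw [v_prod, List.map_map, ← hv, ← Finset.sum_map_toList]; rfl
  · rw [c_prod_of_forall_det_eq_zero, List.map_map, ← hc, ← Finset.sum_map_toList]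
    · rfl
    · simpa using hdet

/-- If two terms do not commute, the central products of a sequence include the two values that
differ by `1` and `-1` from the value expected from additivity of `c`: if interchanging the two
terms at the front does not reach both, it does after reversing the remaining terms. -/
theorem one_mem_products_of_sum_c_ne_zero {i j : ι} (hi : i ∈ T) (hj : j ∈ T)
    (hij : det (H.v (f i)) (H.v (f j)) ≠ 0) (hv : ∑ i ∈ T, H.v (f i) = 0)
    (hc : ∑ i ∈ T, H.c (f i) ≠ 0) : (1 : G) ∈ products (T.val.map f) := by
  classical
  have hne : j ≠ i := by
    rintro rfl
    exact hij (det_self _)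
  have hj' : j ∈ T.erase i := Finset.mem_erase.mpr ⟨hne, hj⟩
  set r := ((T.erase i).erase j).toList.map f with hr
  have hT : ((f i :: f j :: r : List G) : Multiset G) = T.val.map f := by
    rw [hr, ← Multiset.cons_coe, ← Multiset.cons_coe, ← Multiset.map_coe, Finset.coe_toList,
      ← Multiset.map_cons, ← Multiset.map_cons, Finset.erase_val, Multiset.cons_erase hj',
      Finset.erase_val, Multiset.cons_erase hi]
  have hT' : ((f j :: f i :: r : List G) : Multiset G) = T.val.map f := by
    rw [← hT, Multiset.coe_eq_coe]
    exact List.Perm.swap _ _ _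
  rw [← sum_map_eq_of_coe_eq_map hT, List.map_cons, List.map_cons, List.sum_cons,
    List.sum_cons] at hv hc
  have key : ∀ r' : List G, r'.Perm r → H.c (f i) + H.c (f j) + H.c r'.prod ≠ 0 →
      (1 : G) ∈ products (T.val.map f) := by
    intro r' hp hK
    have hvr : H.v r'.prod = (r.map H.v).sum := by rw [v_prod, (hp.map _).sum_eq]
    have hdec : ∀ K w : ZMod 3, K ≠ 0 → w ≠ 0 → K + w = 0 ∨ K - w = 0 := by decide
    rcases hdec _ _ hK hij with h | h
    · refine ⟨f i :: f j :: r', ?_, H.eq_one _ ?_ ?_⟩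
      · rw [← hT, Multiset.coe_eq_coe]
        exact (hp.cons _).cons _
      · simpa [H.v_mul, hvr] using hv
      · rw [List.prod_cons, List.prod_cons, ← mul_assoc, c_mul_mul_of_v_eq_zero, h]
        rw [hvr, add_assoc, hv]
    · refine ⟨f j :: f i :: r', ?_, H.eq_one _ ?_ ?_⟩
      · rw [← hT', Multiset.coe_eq_coe]
        exact (hp.cons _).cons _
      · simpa [H.v_mul, hvr, add_left_comm] using hv
      · rw [List.prod_cons, List.prod_cons, ← mul_assoc, c_mul_mul_of_v_eq_zero, det_swap, ← h]
        · ring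
        · rw [hvr, add_assoc, add_left_comm, hv]
  by_cases hK : H.c (f i) + H.c (f j) + H.c r.prod = 0
  · refine key r.reverse r.reverse_perm fun h => hc ?_
    have h2 : (2 : ZMod 3) * (H.c (f i) + (H.c (f j) + (r.map H.c).sum)) = 0 := by
      linear_combination hK + h - H.c_prod_add_c_prod_reverse r
    exact (mul_eq_zero.mp h2).resolve_left (by decide)
  · exact key r (List.Perm.refl _) hK

/-- Two disjoint pairs of non-commuting terms give four products, which cover all central values. -/
theorem one_mem_products_of_two_pairs {i j k m : ι} (hi : i ∈ T) (hj : j ∈ T) (hk : k ∈ T)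
    (hm : m ∈ T) (hki : k ≠ i) (hkj : k ≠ j) (hmi : m ≠ i) (hmj : m ≠ j)
    (hij : det (H.v (f i)) (H.v (f j)) ≠ 0) (hkm : det (H.v (f k)) (H.v (f m)) ≠ 0)
    (hv : ∑ i ∈ T, H.v (f i) = 0) : (1 : G) ∈ products (T.val.map f) := by
  classical
  have hji : j ≠ i := by
    rintro rfl
    exact hij (det_self _)
  have hmk : m ≠ k := by
    rintro rfl
    exact hkm (det_self _)
  obtain ⟨r, hr⟩ : ∃ r : List G, ((f i :: f j :: f k :: f m :: r : List G) : Multiset G)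
      = T.val.map f := by
    refine ⟨((((T.erase i).erase j).erase k).erase m).toList.map f, ?_⟩
    simp only [← Multiset.cons_coe, ← Multiset.map_coe, Finset.coe_toList]
    simp only [← Multiset.map_cons]
    have h1 : j ∈ T.erase i := by simp [*]
    have h2 : k ∈ (T.erase i).erase j := by simp [*]
    have h3 : m ∈ ((T.erase i).erase j).erase k := by simp [*]
    rw [Finset.erase_val, Multiset.cons_erase h3, Finset.erase_val, Multiset.cons_erase h2,
      Finset.erase_val, Multiset.cons_erase h1,
      Finset.erase_val, Multiset.cons_erase hi]
  have hv' : H.v (f i) + (H.v (f j) + (H.v (f k) + (H.v (f m) + (r.map H.v).sum))) = 0 := by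
    rw [← hv, ← sum_map_eq_of_coe_eq_map hr]
    simp
  rw [← H.v_prod] at hv'
  have key : ∀ x y a b : G, [x, y, a, b].Perm [f i, f j, f k, f m] →
      H.c x + H.c y + (H.c a + H.c b + H.c r.prod + det (H.v a) (H.v b) +
        det (H.v a + H.v b) (H.v r.prod)) + det (H.v x) (H.v y) = 0 →
      (1 : G) ∈ products (T.val.map f) := by
    intro x y a b hp h
    have hv0 : H.v x + H.v y + H.v (a * b * r.prod) = 0 := by
      have := (hp.map H.v).sum_eq
      simp only [List.map_cons, List.map_nil, List.sum_cons, List.sum_nil, add_zero] at this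
      rw [H.v_mul, H.v_mul, ← hv']
      calc _ = (H.v x + (H.v y + (H.v a + H.v b))) + H.v r.prod := by abel
        _ = _ := by rw [this]; abel
    have he : (x :: y :: a :: b :: r).prod = x * y * (a * b * r.prod) := by
      simp only [List.prod_cons, mul_assoc]
    refine ⟨x :: y :: a :: b :: r, ?_, H.eq_one _ ?_ ?_⟩
    · rw [← hr, Multiset.coe_eq_coe]
      exact hp.append_right r
    · rw [he, H.v_mul, H.v_mul, hv0]
    · rw [he, c_mul_mul_of_v_eq_zero _ hv0, H.c_mul (a * b), H.c_mul a, H.v_mul]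
      linear_combination h
  have hdec : ∀ K w w' : ZMod 3, w ≠ 0 → w' ≠ 0 →
      K + w + w' = 0 ∨ K + w - w' = 0 ∨ K - w + w' = 0 ∨ K - w - w' = 0 := by decide
  have hs1 : [f j, f i].Perm [f i, f j] := List.Perm.swap _ _ _
  have hs2 : [f m, f k].Perm [f k, f m] := List.Perm.swap _ _ _
  rcases hdec (H.c (f i) + H.c (f j) + (H.c (f k) + H.c (f m) + H.c r.prod) +
    det (H.v (f k) + H.v (f m)) (H.v r.prod)) _ _ hij hkm with h | h | h | h
  · exact key (f i) (f j) (f k) (f m) (List.Perm.refl _) (by linear_combination h)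
  · refine key (f i) (f j) (f m) (f k) (hs2.append_left [f i, f j]) ?_
    rw [det_swap (H.v (f k)), add_comm (H.v (f m))]
    linear_combination h
  · refine key (f j) (f i) (f k) (f m) (hs1.append_right [f k, f m]) ?_
    rw [det_swap (H.v (f i))]
    linear_combination h
  · refine key (f j) (f i) (f m) (f k) (hs1.append hs2) ?_
    rw [det_swap (H.v (f k)), det_swap (H.v (f i)), add_comm (H.v (f m))]
    linear_combination h

/-- In a zero-sum family a non-commuting pair is never isolated: its second member fails to commute
with a third one. -/
theorem exists_third_of_sum_v_eq_zero {i j : ι} (hi : i ∈ T)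
    (hij : det (H.v (f i)) (H.v (f j)) ≠ 0) (hv : ∑ i ∈ T, H.v (f i) = 0) :
    ∃ k ∈ T, k ≠ i ∧ k ≠ j ∧ det (H.v (f k)) (H.v (f j)) ≠ 0 := by
  classical
  have h : ∑ k ∈ T, det (H.v (f k)) (H.v (f j)) = 0 := by
    rw [← det_sum_left, hv, det_zero_left]
  rw [← Finset.add_sum_erase _ _ hi] at h
  obtain ⟨k, hk, hk'⟩ := Finset.exists_ne_zero_of_sum_ne_zero
    (s := T.erase i) (f := fun k => det (H.v (f k)) (H.v (f j))) fun h0 => hij (by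
      rw [h0, add_zero] at h
      exact h)
  refine ⟨k, (Finset.mem_erase.mp hk).2, (Finset.mem_erase.mp hk).1, ?_, hk'⟩
  rintro rfl
  exact hk' (det_self _)

/-- A zero-sum family with a non-commuting pair and at least four non-central members contains two
disjoint non-commuting pairs. -/
theorem one_mem_products_of_four_le_card {i j : ι} (hi : i ∈ T) (hj : j ∈ T)
    (hij : det (H.v (f i)) (H.v (f j)) ≠ 0) (hv : ∑ i ∈ T, H.v (f i) = 0)
    {U : Finset ι} (hUT : U ⊆ T) (hU : 4 ≤ U.card) (hUv : ∀ k ∈ U, H.v (f k) ≠ 0) :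
    (1 : G) ∈ products (T.val.map f) := by
  classical
  have hne : i ≠ j := by
    rintro rfl
    exact hij (det_self _)
  have hji : det (H.v (f j)) (H.v (f i)) ≠ 0 := by
    rw [det_swap]
    exact neg_ne_zero.mpr hij
  obtain ⟨a, ha, hai, haj, hadet⟩ := H.exists_third_of_sum_v_eq_zero hi hij hv
  obtain ⟨b, hb, hbj, hbi, hbdet⟩ := H.exists_third_of_sum_v_eq_zero hj hji hv
  by_cases hab : a = b
  · -- `i`, `j`, `a` are pairwise non-commuting, and a fourth member pairs with `i` or `j`
    subst hab
    obtain ⟨d, hd, hd'⟩ : ∃ d ∈ U, d ∉ ({i, j, a} : Finset ι) := by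
      refine Finset.exists_mem_notMem_of_card_lt_card (lt_of_le_of_lt Finset.card_le_three ?_)
      omega
    simp only [Finset.mem_insert, Finset.mem_singleton, not_or] at hd'
    obtain ⟨hdi, hdj, hda⟩ := hd'
    rcases det_ne_zero_or_of_ne_zero hij (hUv d hd) with h | h
    · exact H.one_mem_products_of_two_pairs ha hj (hUT hd) hi hda hdj hai.symm hne hadet h hv
    · exact H.one_mem_products_of_two_pairs ha hi (hUT hd) hj hda hdi haj.symm hne.symm hbdet h hv
  · exact H.one_mem_products_of_two_pairs ha hj hb hi (Ne.symm hab) hbj hai.symm hne hadet hbdet hv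

/-- A zero-sum family in all three coordinates is product-one unless its non-central members are
three pairwise non-commuting elements. -/
theorem one_mem_products_or_exists_triple (hv : ∑ i ∈ T, H.v (f i) = 0)
    (hc : ∑ i ∈ T, H.c (f i) = 0) :
    (1 : G) ∈ products (T.val.map f) ∨
      ∃ U ⊆ T, U.card = 3 ∧ (∀ i ∈ U, ∀ j ∈ U, i ≠ j → det (H.v (f i)) (H.v (f j)) ≠ 0) ∧
        (∀ i ∈ T, i ∉ U → H.v (f i) = 0) ∧ ∑ i ∈ U, H.v (f i) = 0 := by
  classical
  by_cases hdet : ∀ i ∈ T, ∀ j ∈ T, det (H.v (f i)) (H.v (f j)) = 0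
  · exact Or.inl (H.one_mem_products_of_forall_det_eq_zero hdet hv hc)
  push Not at hdet
  obtain ⟨i, hi, j, hj, hij⟩ := hdet
  by_cases h4 : 4 ≤ (T.filter fun k => H.v (f k) ≠ 0).card
  · exact Or.inl (H.one_mem_products_of_four_le_card hi hj hij hv (Finset.filter_subset _ _) h4
      (by simp))
  right
  have hne : i ≠ j := by
    rintro rfl
    exact hij (det_self _)
  have hji : det (H.v (f j)) (H.v (f i)) ≠ 0 := by
    rw [det_swap]
    exact neg_ne_zero.mpr hij
  have hfil : ∀ {k m}, k ∈ T → det (H.v (f k)) (H.v (f m)) ≠ 0 →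
      k ∈ T.filter fun k => H.v (f k) ≠ 0 := by
    intro k m hk h
    refine Finset.mem_filter.mpr ⟨hk, fun h0 => h ?_⟩
    rw [h0, det_zero_left]
  obtain ⟨a, ha, hai, haj, hadet⟩ := H.exists_third_of_sum_v_eq_zero hi hij hv
  obtain ⟨b, hb, hbj, hbi, hbdet⟩ := H.exists_third_of_sum_v_eq_zero hj hji hv
  have hsub : ({i, j, a} : Finset ι) ⊆ T.filter fun k => H.v (f k) ≠ 0 := by
    simp only [Finset.insert_subset_iff, Finset.singleton_subset_iff]
    exact ⟨hfil hi hij, hfil hj hji, hfil ha hadet⟩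
  have hcard : ({i, j, a} : Finset ι).card = 3 :=
    Finset.card_eq_three.mpr ⟨i, j, a, hne, hai.symm, haj.symm, rfl⟩
  have heq := Finset.eq_of_subset_of_card_le hsub (by omega)
  have hba : b = a := by
    have := hfil hb hbdet
    rw [← heq] at this
    simpa [hbi, hbj] using this
  subst hba
  have hneg : ∀ {u w}, det u w ≠ 0 → det w u ≠ 0 := fun h => by
    rw [det_swap]
    exact neg_ne_zero.mpr h
  refine ⟨{i, j, b}, hsub.trans (Finset.filter_subset _ _), hcard, ?_, fun k hk hkU => ?_, ?_⟩
  · intro k hk m hm hkm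
    simp only [Finset.mem_insert, Finset.mem_singleton] at hk hm
    rcases hk with rfl | rfl | rfl <;> rcases hm with rfl | rfl | rfl <;>
      first | exact absurd rfl hkm | assumption | exact hneg ‹_›
  · rw [heq, Finset.mem_filter, not_and, not_not] at hkU
    exact hkU hk
  · rw [← hv]
    refine Finset.sum_subset (hsub.trans (Finset.filter_subset _ _)) fun k hk hkU => ?_
    rw [heq, Finset.mem_filter, not_and, not_not] at hkU
    exact hkU hk

end HeisenbergCoordinates

/-! ### The upper bounds -/

/-- Three pairwise independent vectors of `(ZMod 3) ^ 2` with sum zero, together with four further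
vectors, contain a zero-sum subfamily of length at least four that is not contained in a line. -/
theorem exists_four_le_card_sum_eq_zero {ι : Type*} [DecidableEq ι] (u : ι → ZMod 3 × ZMod 3)
    {U A : Finset ι} (hU : U.card = 3)
    (hdet : ∀ i ∈ U, ∀ j ∈ U, i ≠ j → det (u i) (u j) ≠ 0) (hsum : ∑ i ∈ U, u i = 0)
    (hUA : Disjoint U A) (hA : A.card = 4) :
    ∃ W ⊆ U ∪ A, 4 ≤ W.card ∧ ∑ i ∈ W, u i = 0 ∧ ∃ i ∈ W, ∃ j ∈ W, det (u i) (u j) ≠ 0 := by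
  by_contra! hno
  have hpair : ∃ i ∈ U, ∃ j ∈ U, i ≠ j := Finset.one_lt_card.mp (by omega)
  -- otherwise each of the three vectors recurs among the further ones, and the union of the two
  -- copies of the triple is a zero-sum family of length six
  have hstep : ∀ x ∈ U, ∃ w ∈ A, u w = u x := by
    intro x hx
    have hxA : x ∉ A := Finset.disjoint_left.mp hUA hx
    have hux : u x ≠ 0 := by
      intro h0
      obtain ⟨y, hy, hyx⟩ := Finset.exists_mem_ne (by omega : 1 < U.card) x
      exact hdet x hx y hy hyx.symm (by rw [h0, det_zero_left])
    -- a zero-sum subfamily of the four vectors and `-u x`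
    obtain ⟨W, hW, hWne, hW0⟩ := exists_nonempty_subset_sum_eq_zero (insert x A)
      ![fun i => (Function.update u x (-u x) i).1, fun i => (Function.update u x (-u x) i).2]
      (by rw [Finset.card_insert_of_notMem hxA, hA]; simp)
    have hWsum : ∑ i ∈ W, Function.update u x (-u x) i = 0 := by
      ext
      · simpa [Prod.fst_sum] using hW0 0
      · simpa [Prod.snd_sum] using hW0 1
    have hupd : ∑ i ∈ W.erase x, Function.update u x (-u x) i = ∑ i ∈ W.erase x, u i :=
      Finset.sum_congr rfl fun i hi => Function.update_of_ne (Finset.ne_of_mem_erase hi) _ _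
    have hWA : W.erase x ⊆ A := by
      intro i hi
      obtain ⟨hix, hiW⟩ := Finset.mem_erase.mp hi
      exact (Finset.mem_insert.mp (hW hiW)).resolve_left hix
    by_cases hxW : x ∈ W
    · rw [← Finset.add_sum_erase _ _ hxW, hupd, Function.update_self, neg_add_eq_zero] at hWsum
      by_cases h2 : 2 ≤ (W.erase x).card
      · exfalso
        have hdisj : Disjoint (U.erase x) (W.erase x) :=
          hUA.mono (Finset.erase_subset _ _) hWA
        have hcard : (U.erase x).card = 2 := by rw [Finset.card_erase_of_mem hx, hU]
        obtain ⟨i, hi, j, hj, hij⟩ := Finset.one_lt_card.mp (by omega : 1 < (U.erase x).card)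
        refine hdet i (Finset.mem_of_mem_erase hi) j (Finset.mem_of_mem_erase hj) hij
          (hno _ (Finset.union_subset_union (Finset.erase_subset _ _) hWA) ?_ ?_
            i (Finset.mem_union_left _ hi) j (Finset.mem_union_left _ hj))
        · rw [Finset.card_union_of_disjoint hdisj]
          omega
        · rw [Finset.sum_union hdisj, ← hWsum, Finset.sum_erase_add _ _ hx, hsum]
      · interval_cases h : (W.erase x).card
        · rw [Finset.card_eq_zero.mp h, Finset.sum_empty] at hWsum
          exact absurd hWsum hux
        · obtain ⟨w, hw⟩ := Finset.card_eq_one.mp h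
          rw [hw, Finset.sum_singleton] at hWsum
          exact ⟨w, hWA (by simp [hw]), hWsum.symm⟩
    · exfalso
      rw [Finset.erase_eq_of_notMem hxW] at hupd hWA
      have hdisj := hUA.mono_right hWA
      obtain ⟨i, hi, j, hj, hij⟩ := hpair
      refine hdet i hi j hj hij (hno _ (Finset.union_subset_union_right hWA) ?_ ?_
        i (Finset.mem_union_left _ hi) j (Finset.mem_union_left _ hj))
      · have := hWne.card_pos
        rw [Finset.card_union_of_disjoint hdisj]
        omega
      · rw [Finset.sum_union hdisj, hsum, ← hupd, hWsum, add_zero]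
  choose! w hwA hw using hstep
  have hinj : Set.InjOn w U := by
    intro i hi j hj hij
    by_contra hne
    apply hdet i hi j hj hne
    rw [← hw i hi, ← hw j hj, hij, det_self]
  have hsub : U.image w ⊆ A := Finset.image_subset_iff.mpr hwA
  have hdisj := hUA.mono_right hsub
  obtain ⟨i, hi, j, hj, hij⟩ := hpair
  refine hdet i hi j hj hij (hno _ (Finset.union_subset_union_right hsub) ?_ ?_
    i (Finset.mem_union_left _ hi) j (Finset.mem_union_left _ hj))
  · rw [Finset.card_union_of_disjoint hdisj]
    have := Finset.card_image_of_injOn hinj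
    omega
  · rw [Finset.sum_union hdisj, Finset.sum_image hinj, Finset.sum_congr rfl hw, hsum, add_zero]

namespace HeisenbergCoordinates

variable {G : Type*} [Group G]

theorem ne_zero_of_mem_triple (H : HeisenbergCoordinates G) {ι : Type*} {f : ι → G} {U : Finset ι}
    (hU : U.card = 3)
    (hdet : ∀ i ∈ U, ∀ j ∈ U, i ≠ j → det (H.v (f i)) (H.v (f j)) ≠ 0) {i : ι} (hi : i ∈ U) :
    H.v (f i) ≠ 0 := by
  intro h0
  obtain ⟨j, hj, hji⟩ := Finset.exists_mem_ne (by omega : 1 < U.card) i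
  exact hdet i hi j hj hji.symm (by rw [h0, det_zero_left])

/-- The three coordinates as a family of functions into `ZMod 3`. -/
def coords (H : HeisenbergCoordinates G) (k : Fin 3) (x : G) : ZMod 3 :=
  ![(H.v x).1, (H.v x).2, H.c x] k

theorem sum_eq_zero_of_coords (H : HeisenbergCoordinates G) {ι : Type*} {f : ι → G} {T : Finset ι}
    (h : ∀ k, ∑ i ∈ T, H.coords k (f i) = 0) :
    ∑ i ∈ T, H.v (f i) = 0 ∧ ∑ i ∈ T, H.c (f i) = 0 := by
  refine ⟨?_, h 2⟩
  ext
  · simpa [coords, Prod.fst_sum] using h 0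
  · simpa [coords, Prod.snd_sum] using h 1

theorem exists_nonempty_one_mem_products (H : HeisenbergCoordinates G) {ι : Type*} [Fintype ι]
    (f : ι → G) (hι : Fintype.card ι = 7) :
    ∃ T : Finset ι, T.Nonempty ∧ (1 : G) ∈ products (T.val.map f) := by
  classical
  obtain ⟨T, -, hT, h⟩ := exists_nonempty_subset_sum_eq_zero Finset.univ
    (fun k i => H.coords k (f i)) (by simp [hι])
  obtain ⟨hv, hc⟩ := H.sum_eq_zero_of_coords h
  rcases H.one_mem_products_or_exists_triple hv hc with h1 | ⟨U, -, hU, hdet, -, hUv⟩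
  · exact ⟨T, hT, h1⟩
  obtain ⟨i, hi, j, hj, hij⟩ := Finset.one_lt_card.mp (by omega : 1 < U.card)
  have hijdet := hdet i hi j hj hij
  by_cases hcentral : ∃ k ∉ U, H.v (f k) = 0
  · obtain ⟨k, hkU, hk⟩ := hcentral
    by_cases hcU : ∑ i ∈ U, H.c (f i) = 0
    · by_cases hck : H.c (f k) = 0
      · exact ⟨{k}, Finset.singleton_nonempty k, [f k], by simp, by simp [H.eq_one _ hk hck]⟩
      · refine ⟨insert k U, Finset.insert_nonempty k U, H.one_mem_products_of_sum_c_ne_zero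
          (Finset.mem_insert_of_mem hi) (Finset.mem_insert_of_mem hj) hijdet ?_ ?_⟩
        · rw [Finset.sum_insert hkU, hUv, hk, add_zero]
        · rwa [Finset.sum_insert hkU, hcU, add_zero]
    · exact ⟨U, ⟨i, hi⟩, H.one_mem_products_of_sum_c_ne_zero hi hj hijdet hUv hcU⟩
  · push Not at hcentral
    obtain ⟨W, -, hW4, hW0, a, ha, b, hb, hab⟩ := exists_four_le_card_sum_eq_zero
      (fun i => H.v (f i)) (A := Uᶜ) hU hdet hUv disjoint_compl_right
      (by rw [Finset.card_compl, hU, hι])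
    refine ⟨W, ⟨a, ha⟩, H.one_mem_products_of_four_le_card ha hb hab hW0 subset_rfl hW4
      fun k _ => ?_⟩
    by_cases hk : k ∈ U
    · exact H.ne_zero_of_mem_triple hU hdet hk
    · exact hcentral k hk

theorem exists_card_eq_one_mem_products (H : HeisenbergCoordinates G) {ι : Type*} [Fintype ι]
    (f : ι → G) (hι : Fintype.card ι = 33) :
    ∃ T : Finset ι, T.card = 27 ∧ (1 : G) ∈ products (T.val.map f) := by
  classical
  obtain ⟨T, hT, h⟩ := exists_card_eq_sum_eq_zero hι (fun k i => H.coords k (f i))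
  obtain ⟨hv, hc⟩ := H.sum_eq_zero_of_coords h
  rcases H.one_mem_products_or_exists_triple hv hc with h1 | ⟨U, hUT, hU, hdet, hTU, hUv⟩
  · exact ⟨T, hT, h1⟩
  obtain ⟨i, hi, j, hj, hij⟩ := Finset.one_lt_card.mp (by omega : 1 < U.card)
  have hijdet := hdet i hi j hj hij
  set N : Finset ι := Finset.univ.filter fun k => H.v (f k) ≠ 0 with hN
  have hmemN : ∀ {k}, k ∈ N ↔ H.v (f k) ≠ 0 := by simp [hN]
  have hUN : U ⊆ N := fun k hk => hmemN.mpr (H.ne_zero_of_mem_triple hU hdet hk)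
  have hTUcard : (T \ U).card = 24 := by rw [Finset.card_sdiff_of_subset hUT, hT, hU]
  have hTU' : ∀ k ∈ T \ U, H.v (f k) = 0 := fun k hk =>
    hTU k (Finset.mem_sdiff.mp hk).1 (Finset.mem_sdiff.mp hk).2
  by_cases h7 : 7 ≤ N.card
  · -- a long non-collinear zero-sum family of non-central terms, filled up with central ones
    obtain ⟨A, hA, hA4⟩ := Finset.exists_subset_card_eq (s := N \ U) (n := 4)
      (by rw [Finset.card_sdiff_of_subset hUN]; omega)
    have hUA : Disjoint U A := Finset.disjoint_sdiff.mono_right hA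
    obtain ⟨W, hW, hW4, hW0, a, ha, b, hb, hab⟩ := exists_four_le_card_sum_eq_zero
      (fun i => H.v (f i)) hU hdet hUv hUA hA4
    have hW7 : W.card ≤ 7 := by
      have := Finset.card_le_card hW
      rwa [Finset.card_union_of_disjoint hUA, hU, hA4] at this
    have hWN : W ⊆ N := hW.trans (Finset.union_subset hUN (hA.trans Finset.sdiff_subset))
    obtain ⟨D, hD, hDcard⟩ := Finset.exists_subset_card_eq (s := T \ U) (n := 27 - W.card)
      (by omega)
    have hWD : Disjoint W D := Finset.disjoint_left.mpr fun k hkW hkD =>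
      hmemN.mp (hWN hkW) (hTU' k (hD hkD))
    refine ⟨W ∪ D, ?_, H.one_mem_products_of_four_le_card (Finset.mem_union_left _ ha)
      (Finset.mem_union_left _ hb) hab ?_ Finset.subset_union_left hW4
      fun k hk => hmemN.mp (hWN hk)⟩
    · rw [Finset.card_union_of_disjoint hWD]
      omega
    · rw [Finset.sum_union hWD, hW0, Finset.sum_eq_zero fun k hk => hTU' k (hD hk), add_zero]
  · have hNc : ∀ {k}, k ∈ Nᶜ ↔ H.v (f k) = 0 := by simp [hN]
    have hNccard : 27 ≤ Nᶜ.card := by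
      rw [Finset.card_compl, hι]
      omega
    by_cases hswap : ∃ k ∈ T \ U, ∃ m ∈ Nᶜ, m ∉ T ∧ H.c (f m) ≠ H.c (f k)
    · -- exchanging a central term for a different one changes the sum of `c`
      obtain ⟨k, hk, m, hm, hmT, hmk⟩ := hswap
      obtain ⟨hkT, hkU⟩ := Finset.mem_sdiff.mp hk
      have hmT' : m ∉ T.erase k := fun h => hmT (Finset.mem_of_mem_erase h)
      have hmem : ∀ {x}, x ∈ U → x ∈ insert m (T.erase k) := fun {x} hx =>
        Finset.mem_insert_of_mem (Finset.mem_erase.mpr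
          ⟨fun h => hkU (h ▸ hx), hUT hx⟩)
      refine ⟨insert m (T.erase k), ?_, H.one_mem_products_of_sum_c_ne_zero (hmem hi) (hmem hj)
        hijdet ?_ ?_⟩
      · rw [Finset.card_insert_of_notMem hmT', Finset.card_erase_of_mem hkT, hT]
      · rw [← Finset.add_sum_erase _ _ hkT, hTU k hkT hkU, zero_add] at hv
        rw [Finset.sum_insert hmT', hv, hNc.mp hm, add_zero]
      · rw [← Finset.add_sum_erase _ _ hkT] at hc
        rw [Finset.sum_insert hmT']
        intro h0
        apply hmk
        linear_combination h0 - hc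
    · -- all central terms are equal, and 27 of them have product one
      push Not at hswap
      obtain ⟨k₀, hk₀⟩ : (T \ U).Nonempty := Finset.card_pos.mp (by omega)
      obtain ⟨m₀, hm₀, hm₀T⟩ : ∃ m ∈ Nᶜ, m ∉ T := by
        by_contra! hsub
        have h1 : Nᶜ ⊆ T \ U := fun k hk => Finset.mem_sdiff.mpr
          ⟨hsub k hk, fun hkU => Finset.mem_compl.mp hk (hUN hkU)⟩
        have := Finset.card_le_card h1
        omega
      have hconst : ∀ k ∈ Nᶜ, H.c (f k) = H.c (f m₀) := by
        intro k hk
        by_cases hkT : k ∈ T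
        · exact (hswap k (Finset.mem_sdiff.mpr
            ⟨hkT, fun hkU => Finset.mem_compl.mp hk (hUN hkU)⟩) m₀ hm₀ hm₀T).symm
        · rw [hswap k₀ hk₀ k hk hkT, hswap k₀ hk₀ m₀ hm₀ hm₀T]
      obtain ⟨D, hD, hDcard⟩ := Finset.exists_subset_card_eq hNccard
      refine ⟨D, hDcard, H.one_mem_products_of_forall_det_eq_zero (fun a ha b _ => ?_) ?_ ?_⟩
      · rw [hNc.mp (hD ha), det_zero_left]
      · exact Finset.sum_eq_zero fun k hk => hNc.mp (hD hk)
      · rw [Finset.sum_congr rfl fun k hk => hconst k (hD hk), Finset.sum_const, hDcard,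
          nsmul_eq_mul, show ((27 : ℕ) : ZMod 3) = 0 from rfl, zero_mul]

end HeisenbergCoordinates

theorem exists_le_card_eq {α : Type*} (S : Multiset α) {n : ℕ} (h : n ≤ Multiset.card S) :
    ∃ T ≤ S, Multiset.card T = n := by
  induction S using Quotient.inductionOn with
  | h l => exact ⟨l.take n, (List.take_sublist n l).subperm, by simpa using h⟩

/-- A sequence of length at least `n` contains a subsequence indexed by a type with `n` elements,
whose subfamilies are subsequences of the given one. -/
theorem exists_index_of_le_card {α : Type*} (S : Multiset α) {n : ℕ} (h : n ≤ Multiset.card S) :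
    ∃ f : Fin n → α, ∀ T : Finset (Fin n), T.val.map f ≤ S := by
  obtain ⟨S', hS', rfl⟩ := exists_le_card_eq S h
  induction S' using Quotient.inductionOn with
  | h l =>
    refine ⟨fun i => l.get i, fun T => le_trans (Multiset.map_le_map
      (Finset.val_le_iff.mpr (Finset.subset_univ T))) (le_trans (le_of_eq ?_) hS')⟩
    exact (Fin.univ_val_map l.get).trans (congrArg _ (List.ofFn_get l))

/-! ### The lower bounds -/

theorem one_mem_products_filter_ne_one {G : Type*} [Group G] [DecidableEq G] {T : Sequence G}
    (h : (1 : G) ∈ products T) : (1 : G) ∈ products (T.filter (· ≠ 1)) := by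
  obtain ⟨l, rfl, hl⟩ := h
  have hfilter : ∀ l : List G, (l.filter (· ≠ 1)).prod = l.prod := by
    intro l
    induction l with
    | nil => rfl
    | cons x l ih => by_cases hx : x = 1 <;> simpa [hx] using ih
  exact ⟨l.filter (· ≠ 1), by simp, (hfilter l).trans hl⟩

/-- Appending `|G| - 1` copies of `1` to a product-one free sequence gives a sequence without
product-one subsequence of length `|G|`. -/
theorem add_card_le_of_mem_gaoBounds {G : Type*} [Group G] [Finite G] {n N : ℕ}
    (hn : n ∈ productOneFreeLengths G) (hN : N ∈ gaoBounds G) : n + Nat.card G ≤ N := by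
  classical
  obtain ⟨F, rfl, hF⟩ := hn
  have hG : 0 < Nat.card G := Nat.card_pos
  by_contra! hlt
  obtain ⟨T, hT, hTcard, hT1⟩ := hN.2 (Multiset.replicate (Nat.card G - 1) 1 + F) (by
    rw [Multiset.card_add, Multiset.card_replicate]
    omega)
  have h1F : (1 : G) ∉ F := fun h =>
    hF ⟨{1}, Multiset.singleton_ne_zero 1, Multiset.singleton_le.mpr h, [1], rfl, by simp⟩
  have hle : T.filter (· ≠ 1) ≤ F := by
    refine (Multiset.filter_le_filter _ hT).trans ?_
    rw [Multiset.filter_add, Multiset.filter_eq_nil.mpr, zero_add]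
    · exact Multiset.filter_le _ _
    · intro a ha
      simp [Multiset.eq_of_mem_replicate ha]
  refine hF ⟨T.filter (· ≠ 1), fun h0 => ?_, hle, one_mem_products_filter_ne_one hT1⟩
  have hcount : T.count 1 = Multiset.card T := Multiset.count_eq_card.mpr fun x hx => by
    by_contra hne
    exact Multiset.filter_eq_nil.mp h0 x hx fun h => hne h.symm
  have := Multiset.count_le_of_le 1 hT
  rw [Multiset.count_add, Multiset.count_replicate_self, Multiset.count_eq_zero.mpr h1F] at this
  omega

theorem exists_add_eq_of_le_add {α : Type*} [DecidableEq α] {T A B : Multiset α}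
    (h : T ≤ A + B) : ∃ T₁ ≤ A, ∃ T₂ ≤ B, T = T₁ + T₂ :=
  ⟨T ∩ A, Multiset.inter_le_right, T - A, tsub_le_iff_left.mpr h, by
    rw [add_comm, Multiset.sub_add_inter]⟩

/-- For a basis `x`, `y`, `z` of the coordinate space, the sequence `x, x, y, y, z, z` has no
non-empty product-one subsequence. -/
theorem HeisenbergCoordinates.six_mem_productOneFreeLengths {G : Type*} [Group G]
    (H : HeisenbergCoordinates G) : 6 ∈ productOneFreeLengths G := by
  classical
  obtain ⟨x, hxv, -⟩ := H.surj (1, 0) 0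
  obtain ⟨y, hyv, -⟩ := H.surj (0, 1) 0
  obtain ⟨z, hzv, hzc⟩ := H.surj 0 1
  refine ⟨Multiset.replicate 2 x + Multiset.replicate 2 y + Multiset.replicate 2 z, by simp, ?_⟩
  rintro ⟨T, hT0, hT, l, hl, hl1⟩
  obtain ⟨T', hT', T₃, h₃, rfl⟩ := exists_add_eq_of_le_add hT
  obtain ⟨T₁, h₁, T₂, h₂, rfl⟩ := exists_add_eq_of_le_add hT'
  obtain ⟨i, hi, rfl⟩ := Multiset.le_replicate_iff.mp h₁
  obtain ⟨j, hj, rfl⟩ := Multiset.le_replicate_iff.mp h₂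
  obtain ⟨k, hk, rfl⟩ := Multiset.le_replicate_iff.mp h₃
  have hzero : ∀ n : ℕ, n ≤ 2 → (n : ZMod 3) = 0 → n = 0 := by decide
  have hv : (i : ZMod 3) = 0 ∧ (j : ZMod 3) = 0 := by
    have h := H.v_prod l
    rw [hl1, H.v_one, ← Multiset.sum_coe, ← Multiset.map_coe, hl] at h
    simpa [hxv, hyv, hzv, eq_comm, Prod.ext_iff] using h
  obtain rfl := hzero i hi hv.1
  obtain rfl := hzero j hj hv.2
  have hlz : l = List.replicate k z := by
    rw [Multiset.replicate_zero, Multiset.replicate_zero, zero_add, zero_add,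
      ← Multiset.coe_replicate, Multiset.coe_eq_coe] at hl
    exact List.perm_replicate.mp hl
  have hc := H.c_prod_of_forall_det_eq_zero l fun a ha b _ => by
    rw [hlz] at ha
    rw [List.eq_of_mem_replicate ha, hzv, det_zero_left]
  rw [hl1, H.c_one, hlz] at hc
  obtain rfl := hzero k hk (by simpa [hzc, eq_comm] using hc)
  simp at hT0

end ProductOne

theorem theorem1p4 (G : Type*) [Group G] (hcard : Nat.card G = 27)
    (hexp : Monoid.exponent G = 3) (hnonab : ¬ ∀ a b : G, a * b = b * a) :
    (IsGreatest (ProductOne.productOneFreeLengths G) 6 ∧ ProductOne.smallDavenport G = 6) ∧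
    (IsLeast (ProductOne.gaoBounds G) 33 ∧ ProductOne.gaoConstant G = 33) ∧
    ProductOne.gaoConstant G = ProductOne.smallDavenport G + Nat.card G := by
  obtain ⟨H⟩ := ProductOne.exists_heisenbergCoordinates hcard hexp hnonab
  have : Finite G := Nat.finite_of_card_ne_zero (by omega)
  have hd : IsGreatest (ProductOne.productOneFreeLengths G) 6 := by
    refine ⟨H.six_mem_productOneFreeLengths, ?_⟩
    rintro n ⟨S, rfl, hS⟩
    by_contra! hlt
    obtain ⟨f, hf⟩ := ProductOne.exists_index_of_le_card S (n := 7) hlt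
    obtain ⟨T, hT, h1⟩ := H.exists_nonempty_one_mem_products f (by simp)
    exact hS ⟨T.val.map f, by simpa using hT.ne_empty, hf T, h1⟩
  have hE : IsLeast (ProductOne.gaoBounds G) 33 := by
    refine ⟨⟨by norm_num, fun S hS => ?_⟩, fun N hN => ?_⟩
    · obtain ⟨f, hf⟩ := ProductOne.exists_index_of_le_card S hS
      obtain ⟨T, hT, h1⟩ := H.exists_card_eq_one_mem_products f (by simp)
      exact ⟨T.val.map f, hf T, by simpa [hcard] using hT, h1⟩
    · have := ProductOne.add_card_le_of_mem_gaoBounds hd.1 hN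
      omega
  have hd' : ProductOne.smallDavenport G = 6 := hd.csSup_eq
  have hE' : ProductOne.gaoConstant G = 33 := hE.csInf_eq
  exact ⟨⟨hd, hd'⟩, ⟨hE, hE'⟩, by rw [hd', hE', hcard]⟩
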